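/- Let $A$ be a finite alphabet, $W_A$ the set of words over $A$ (with empty word $e$), and $\mathcal{A}$ the free associative $\mathbb{R}$-algebra over $A$, i.e. the real vector space with basis $W_A$ and with concatenation $\otimes$ as product. Let $\langle\cdot,\cdot\rangle$ be the scalar product on $\mathcal{A}$ for which $W_A$ is orthonormal. The left half shuffle $\prec$ is the bilinear operation on $\mathcal{A}$ given on words by $e\prec v=0$ for every word $v$, $u\prec e=u$ for $u\neq e$, and $au\prec v=a\,(u\prec v+v\prec u)$ for a letter $a$ and words $u$, $v$ with $v\neq e$. Let $\mathcal{M}_A$ be the free magma over $A$ (binary trees with leaves labelled by $A$). For $t\in\mathcal{M}_A$ let $f(t)\in W_A$ be its foliage (the word of its leaves from left to right), and let $[t]$ and $\prec(t)$ in $\mathcal{A}$ be the values of $t$ obtained by evaluating every node by the commutator $[x,y]=x\otimes y-y\otimes x$, respectively by $\prec$, every leaf being sent to its letter. Let $H\subset\mathcal{M}_A$, with a total order $<$ on $H$, be a Hall set: (1) $t<t''$ whenever $t=(t',t'')\in H$ and $t''\in H$; (2) $A\subset H$; (3) for all $h_1,h_2\in\mathcal{M}_A$, $(h_1,h_2)\in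 H$ if and only if $h_1,h_2\in H$, $h_1<h_2$, and either $h_1\in A$ or $h_1=(h_1',h_1'')$ with $h_2\le h_1''$. Every $h=(h',h'')\in H$ can be written uniquely as $h=(h_1h_2^k)=(\dots((h_1,h_2),h_2)\dots,h_2)$ with $k\ge 1$ and either $h_1\in A$ or $h_1=(h_1',h_1'')$ with $h_1''\neq h_2$. Put $\alpha_h=1/k$, and define the accumulated Lazard depth by $\mathcal{A}_h=1$ for $h\in A$ and $\mathcal{A}_h=\alpha_h\,\mathcal{A}_{h'}\,\mathcal{A}_{h''}$ for $h=(h',h'')\in H$. Theorem. Every word $w\in W_A$ has a unique factorization $w=f(h_1)^{\otimes k_1}\otimes\cdots\otimes f(h_n)^{\otimes k_n}$ with $n \ge 0$, $h_1>\dots>h_n$ in $H$ and $k_i\ge1$. Put $P_w=[h_1]^{\otimes k_1}\otimes\cdots\otimes[h_n]^{\otimes k_n}$. There is a unique family $(S_w)_{w\in W_A}$ in $\mathcal{A}$ with $\langle S_w,P_u\rangle=\delta_{w,u}$ for all $w,u\in W_A$ (the dual basis of the Poincaré–Birkhoff–Witt basis $(P_w)$), and for every Hall tree $h\in H$ $$S_{f(h)}=\mathcal{A}_h\cdot{\prec}(h).$$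 -/

import Mathlib

namespace HallIntegral

noncomputable section

/-- The space spanned by all words over the alphabet `A`, with concatenation (`⊗`) as product:
the tensor algebra over `A`, i.e. the free associative `ℝ`-algebra on `A`. -/
abbrev TensorAlg (A : Type*) := MonoidAlgebra ℝ (FreeMonoid A)

/-- A word, seen as an element of the tensor algebra. -/
def word {A : Type*} (w : FreeMonoid A) : TensorAlg A := MonoidAlgebra.single w 1

/-- A letter, seen as an element of the tensor algebra. -/
def letter {A : Type*} (a : A) : TensorAlg A := word (FreeMonoid.of a)

/-- The scalar product for which the words are orthonormal. -/
def pairing {A : Type*} (x y : TensorAlg A) : ℝ := x.coeff.sum fun w c => c * y.coeff w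

/-- The left half shuffle of two words: `e ≺ v = 0`, `u ≺ e = u` for `u ≠ e`, and
`au ≺ v = a (u ≺ v + v ≺ u)` otherwise. -/
def halfShuffleWord {A : Type*} : List A → List A → TensorAlg A
  | [], _ => 0
  | a :: u, [] => word (FreeMonoid.ofList (a :: u))
  | a :: u, b :: v => letter a * (halfShuffleWord u (b :: v) + halfShuffleWord (b :: v) u)
termination_by u v => u.length + v.length

/-- The left half shuffle product `≺`, the bilinear extension of the half shuffle of words. -/
def halfShuffle {A : Type*} : TensorAlg A →ₗ[ℝ] TensorAlg A →ₗ[ℝ] TensorAlg A :=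
  (MonoidAlgebra.basis (FreeMonoid A) ℝ).constr ℝ fun u =>
    (MonoidAlgebra.basis (FreeMonoid A) ℝ).constr ℝ fun v =>
      halfShuffleWord u.toList v.toList

/-- The value of a tree when its leaves are evaluated by `ι` and its nodes by `φ`. -/
def treeEval {A V : Type*} (φ : V → V → V) (ι : A → V) : FreeMagma A → V
  | .of a => ι a
  | x * y => φ (treeEval φ ι x) (treeEval φ ι y)

/-- The foliage `f(t)` of a tree: the word of its leaves, from left to right. -/
def foliage {A : Type*} (t : FreeMagma A) : FreeMonoid A :=
  treeEval (fun u v => u * v) FreeMonoid.of t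

/-- The iterated Lie bracket `[t]` of a tree, for the commutator `x ⊗ y - y ⊗ x`. -/
def bracket {A : Type*} (t : FreeMagma A) : TensorAlg A :=
  treeEval (fun x y => x * y - y * x) letter t

/-- The iterated half shuffle `≺(t)` of a tree. -/
def halfShuffleTree {A : Type*} (t : FreeMagma A) : TensorAlg A :=
  treeEval (fun x y => halfShuffle x y) letter t

/-- `H`, with the given total order on it, is a Hall set. -/
structure IsHallSet {A : Type*} (H : Set (FreeMagma A)) [LinearOrder H] : Prop where
  /-- The order is ancestral: `(t', t'') < t''`. -/
  ancestral : ∀ (t t'' : H) (t' : FreeMagma A), (t : FreeMagma A) = t' * t'' → t < t''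
  /-- Every letter belongs to `H`. -/
  letter_mem : ∀ a : A, FreeMagma.of a ∈ H
  /-- `(h₁, h₂)` is in `H` if and only if `h₁, h₂ ∈ H`, `h₁ < h₂` and either `h₁` is a letter
  or `h₁ = (h₁', h₁'')` with `h₂ ≤ h₁''`. -/
  mul_mem_iff : ∀ h₁ h₂ : FreeMagma A, h₁ * h₂ ∈ H ↔
    ∃ (m₁ : h₁ ∈ H) (m₂ : h₂ ∈ H), (⟨h₁, m₁⟩ : H) < ⟨h₂, m₂⟩ ∧
      ((∃ a, h₁ = FreeMagma.of a) ∨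
        ∃ (x y : FreeMagma A) (m : y ∈ H), h₁ = x * y ∧ (⟨h₂, m₂⟩ : H) ≤ ⟨y, m⟩)

/-- `l` is a weakly decreasing sequence of Hall trees (equivalently, strictly decreasing Hall trees
`h₁ > ... > hₙ` with multiplicities `k₁, ..., kₙ ≥ 1`) whose foliages concatenate to `w`. -/
def IsHallFactorization {A : Type*} (H : Set (FreeMagma A)) [LinearOrder H]
    (w : FreeMonoid A) (l : List H) : Prop :=
  l.Pairwise (fun h h' => h' ≤ h) ∧ (l.map fun h => foliage (h : FreeMagma A)).prod = w

/-- The product `[h₁] ⊗ ... ⊗ [hₙ]` of the brackets of a sequence of Hall trees. When the sequence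
is the decreasing factorization of a word `w`, this is the element `P_w` of the
Poincaré-Birkhoff-Witt basis. -/
def pbw {A : Type*} {H : Set (FreeMagma A)} (l : List H) : TensorAlg A :=
  (l.map fun h => bracket (h : FreeMagma A)).prod

/-- The family `S` is dual to the Poincaré-Birkhoff-Witt basis `(P_u)` of the Hall set `H`:
`⟨S_w, P_u⟩ = δ_{w,u}` for all words `w` and `u`. -/
def IsDualPBW {A : Type*} (H : Set (FreeMagma A)) [LinearOrder H]
    (S : FreeMonoid A → TensorAlg A) : Prop :=
  ∀ (w u : FreeMonoid A) (l : List H), IsHallFactorization H u l →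
    (w = u → pairing (S w) (pbw l) = 1) ∧ (w ≠ u → pairing (S w) (pbw l) = 0)

/-- `(h₁ h₂ᵏ) = (...((h₁, h₂), h₂), ..., h₂)` with `h₂` repeated `k` times. -/
def rightPow {A : Type*} (h₁ h₂ : FreeMagma A) : ℕ → FreeMagma A
  | 0 => h₁
  | k + 1 => rightPow h₁ h₂ k * h₂

/-- `h = (h₁ h₂ᵏ)` with `k ≥ 1` and either `h₁` a letter or `h₁ = (h₁', h₁'')`, `h₁'' ≠ h₂`. -/
def IsLazardDecomposition {A : Type*} (h h₁ h₂ : FreeMagma A) (k : ℕ) : Prop :=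
  1 ≤ k ∧ h = rightPow h₁ h₂ k ∧
    ((∃ a, h₁ = FreeMagma.of a) ∨ ∃ x y, h₁ = x * y ∧ y ≠ h₂)

open Classical in
/-- The largest `k` such that `t = (h₁ yᵏ)` for some tree `h₁`. -/
def rightMultiplicity {A : Type*} (y : FreeMagma A) : FreeMagma A → ℕ
  | .of _ => 0
  | x * z => if z = y then rightMultiplicity y x + 1 else 0

/-- The exponent `k` in the Lazard decomposition `(h₁ h₂ᵏ)` of a tree that is not a letter. -/
def lazardExponent {A : Type*} : FreeMagma A → ℕ
  | .of _ => 0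
  | x * y => rightMultiplicity y x + 1

theorem exists_rightPow {A : Type*} (y t : FreeMagma A) :
    ∃ h₁, t = rightPow h₁ y (rightMultiplicity y t) ∧
      ((∃ a, h₁ = FreeMagma.of a) ∨ ∃ x z, h₁ = x * z ∧ z ≠ y) := by
  induction t with
  | ih1 a => exact ⟨FreeMagma.of a, rfl, Or.inl ⟨a, rfl⟩⟩
  | ih2 x z ihx _ =>
    by_cases hz : z = y
    · subst hz
      obtain ⟨h₁, e, h⟩ := ihx
      refine ⟨h₁, ?_, h⟩
      simp only [rightMultiplicity, if_true, rightPow]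
      rw [← e]
    · exact ⟨x * z, by simp [rightMultiplicity, hz, rightPow], Or.inr ⟨x, z, rfl, hz⟩⟩

/-- Every tree that is not a letter has a Lazard decomposition with exponent `lazardExponent`. -/
theorem exists_isLazardDecomposition {A : Type*} (x y : FreeMagma A) :
    ∃ h₁, IsLazardDecomposition (x * y) h₁ y (lazardExponent (x * y)) := by
  obtain ⟨h₁, e, h⟩ := exists_rightPow y x
  refine ⟨h₁, Nat.le_add_left _ _, ?_, h⟩
  simp only [lazardExponent, rightPow]
  rw [← e]

theorem rightMultiplicity_rightPow {A : Type*} (h₁ h₂ : FreeMagma A) (k : ℕ)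
    (h : (∃ a, h₁ = FreeMagma.of a) ∨ ∃ x y, h₁ = x * y ∧ y ≠ h₂) :
    rightMultiplicity h₂ (rightPow h₁ h₂ k) = k := by
  induction k with
  | zero =>
    rcases h with ⟨a, rfl⟩ | ⟨x, y, rfl, hy⟩
    · rfl
    · simp [rightPow, rightMultiplicity, hy]
  | succ k ih => simp [rightPow, rightMultiplicity, ih]

/-- The exponent of a Lazard decomposition is unique. -/
theorem IsLazardDecomposition.exponent_eq {A : Type*} {h h₁ h₂ : FreeMagma A} {k : ℕ}
    (hd : IsLazardDecomposition h h₁ h₂ k) : k = lazardExponent h := by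
  obtain ⟨hk, rfl, h⟩ := hd
  obtain ⟨k, rfl⟩ := Nat.exists_eq_add_of_le' hk
  simp [rightPow, lazardExponent, rightMultiplicity_rightPow h₁ h₂ k h]

/-- The Lazard depth `α_h = 1 / k` of a tree `h = (h₁ h₂ᵏ)` that is not a letter. -/
def lazardDepth {A : Type*} (h : FreeMagma A) : ℚ := 1 / (lazardExponent h : ℚ)

/-- The accumulated Lazard depth: `1` on letters and `α_h 𝒜_{h'} 𝒜_{h''}` on `h = (h', h'')`. -/
def accLazardDepth {A : Type*} : FreeMagma A → ℚ
  | .of _ => 1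
  | x * y => lazardDepth (x * y) * accLazardDepth x * accLazardDepth y

end

end HallIntegral

open HallIntegral

namespace HallIntegral
noncomputable section

variable {A : Type*} {H : Set (FreeMagma A)}

open scoped TensorProduct

/-! ### Factorization of words into decreasing sequences of Hall trees. -/

section

/-! Put a letter `a` in front of a decreasing sequence of Hall trees and let it absorb its right
neighbours as long as the product is a Hall tree (`insertTree`). The result is again decreasing, and
every nonempty decreasing sequence arises this way. Induction on the word gives existence and
uniqueness of the factorization.

The same move in the algebra, through `xy = [x,y] + yx`, shows that `a P_u = P_{au}` modulo PBW
products of at least two brackets (`bracket_mul_pbw_sub_mem`). Hence the `P_w` span, and a dimension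
count makes them a basis. A Hall word has a single factor, so its coordinate does not see the error
terms; therefore `S_{av} = a S_v` whenever `av = f(h)` (`dualPBW_foliage`).

The shuffle is dual to the coproduct for which brackets are primitive. So shuffling with `S_{f(y)}`
is adjoint to the formal derivative by `[y]` on PBW monomials (`contract_coord_foliage`), and for
`l` decreasing with all terms `≥ y`, the shuffle of `S_{f(l)}` and `S_{f(y)}` is `S_{f(l)f(y)}`
times the multiplicity of `y` in `l ++ [y]`.

Finally, in `h = (x,y)` the tree `x` is a left comb of a letter `a` and such a sequence `l`. Thus
`S_{f(x)} ≺ S_{f(y)}` is `a` times that shuffle, i.e. `k S_{f(h)}` with `k` the Lazard exponent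
(`halfShuffle_dualPBW`); induction on `h` concludes. -/

@[simp] theorem foliage_of (a : A) : foliage (FreeMagma.of a) = FreeMonoid.of a := rfl

@[simp] theorem foliage_mul (x y : FreeMagma A) : foliage (x * y) = foliage x * foliage y := rfl

@[simp] theorem bracket_of (a : A) : bracket (FreeMagma.of a) = letter a := rfl

@[simp] theorem bracket_mul (x y : FreeMagma A) :
    bracket (x * y) = bracket x * bracket y - bracket y * bracket x := rfl

theorem foliage_ne_one (t : FreeMagma A) : foliage t ≠ 1 := by
  induction t with
  | ih1 a => exact FreeMonoid.of_ne_one a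
  | ih2 x y ihx _ =>
    rw [foliage_mul]
    intro h
    apply ihx
    have := congrArg FreeMonoid.length h
    rw [FreeMonoid.length_mul, FreeMonoid.length_one] at this
    exact FreeMonoid.length_eq_zero.1 (by omega)

/-- The concatenation of the foliages of a sequence of trees. -/
def listFoliage (l : List H) : FreeMonoid A :=
  (l.map fun h => foliage (h : FreeMagma A)).prod

@[simp] theorem listFoliage_nil : listFoliage ([] : List H) = 1 := rfl

@[simp] theorem listFoliage_cons (x : H) (l : List H) :
    listFoliage (x :: l) = foliage x.1 * listFoliage l := by
  simp [listFoliage]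

@[simp] theorem listFoliage_append (l m : List H) :
    listFoliage (l ++ m) = listFoliage l * listFoliage m := by
  simp [listFoliage]

@[simp] theorem pbw_nil : pbw ([] : List H) = 1 := rfl

@[simp] theorem pbw_cons (x : H) (l : List H) : pbw (x :: l) = bracket x.1 * pbw l := by
  simp [pbw]

theorem listFoliage_eq_one {l : List H} (h : listFoliage l = 1) : l = [] := by
  cases l with
  | nil => rfl
  | cons x l =>
    exfalso
    apply foliage_ne_one x.1
    have := congrArg FreeMonoid.length h
    rw [listFoliage_cons, FreeMonoid.length_mul, FreeMonoid.length_one] at this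
    exact FreeMonoid.length_eq_zero.1 (by omega)

open Classical in
/-- Absorb the first trees of a sequence into `x` as long as the result is in `H`. -/
def insertTree (x : H) : List H → List H
  | [] => [x]
  | y :: l => if h : x.1 * y.1 ∈ H then insertTree ⟨x.1 * y.1, h⟩ l else x :: y :: l

theorem listFoliage_insertTree (x : H) (l : List H) :
    listFoliage (insertTree x l) = foliage x.1 * listFoliage l := by
  induction l generalizing x with
  | nil => simp [insertTree]
  | cons y l ih =>
    unfold insertTree
    split_ifs with h
    · rw [ih]; simp [mul_assoc]
    · simp

theorem insertTree_ne_nil (x : H) (l : List H) : insertTree x l ≠ [] := by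
  induction l generalizing x with
  | nil => simp [insertTree]
  | cons y l ih =>
    unfold insertTree
    split_ifs with h
    · exact ih _
    · simp

/-- The left comb `(...((x, h₁), h₂), ..., hₙ)`. -/
def leftComb (x : FreeMagma A) (l : List H) : FreeMagma A := l.foldl (fun t h => t * h.1) x

theorem leftComb_concat (x : FreeMagma A) (l : List H) (y : H) :
    leftComb x (l ++ [y]) = leftComb x l * y.1 := by
  simp [leftComb]

theorem foliage_leftComb (x : FreeMagma A) (l : List H) :
    foliage (leftComb x l) = foliage x * listFoliage l := by
  induction l using List.reverseRecOn with
  | nil => simp [leftComb]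
  | append_singleton l y ih => simp [leftComb_concat, ih, mul_assoc]

variable [LinearOrder H]

/-- A weakly decreasing sequence of trees. -/
abbrev Decreasing (l : List H) : Prop := l.Pairwise fun h h' => h' ≤ h

/-- Every tree of `l` is at most the right subtree of `x`. -/
def Compatible (x : FreeMagma A) (l : List H) : Prop :=
  ∀ y ∈ l, ∀ x₁ x₂ : FreeMagma A, x = x₁ * x₂ → ∀ m : x₂ ∈ H, y ≤ ⟨x₂, m⟩

theorem compatible_of (a : A) (l : List H) : Compatible (FreeMagma.of a) l := by
  intro y _ x₁ x₂ h
  cases h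

theorem Compatible.of_cons {x : FreeMagma A} {y : H} {l : List H} (h : Compatible x (y :: l)) :
    Compatible x l := fun z hz => h z (List.mem_cons_of_mem _ hz)

theorem compatible_mul {x : FreeMagma A} {y : H} {l : List H} (h : Decreasing (y :: l)) :
    Compatible (x * y.1) l := by
  intro z hz x₁ x₂ e m
  cases e
  exact (List.pairwise_cons.1 h).1 z hz

theorem IsHallSet.mul_mem (hH : IsHallSet H) {x y : H} (hxy : x < y)
    (hc : Compatible x.1 [y]) : x.1 * y.1 ∈ H := by
  obtain ⟨x, hx⟩ := x
  refine (hH.mul_mem_iff _ _).2 ⟨hx, y.2, hxy, ?_⟩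
  cases x with
  | of a => exact Or.inl ⟨a, rfl⟩
  | mul x₁ x₂ =>
    obtain ⟨_, m₂, -⟩ := (hH.mul_mem_iff x₁ x₂).1 hx
    exact Or.inr ⟨x₁, x₂, m₂, rfl, hc y (by simp) x₁ x₂ rfl m₂⟩

theorem IsHallSet.lt_of_mul_mem (hH : IsHallSet H) {x y : H} (h : x.1 * y.1 ∈ H) : x < y := by
  obtain ⟨m₁, m₂, h, -⟩ := (hH.mul_mem_iff _ _).1 h
  exact h

theorem IsHallSet.mul_lt (hH : IsHallSet H) {x : FreeMagma A} {y : H} (h : x * y.1 ∈ H) :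
    (⟨x * y.1, h⟩ : H) < y :=
  hH.ancestral ⟨_, h⟩ y x rfl

theorem Compatible.head {x : FreeMagma A} {y : H} {l : List H} (h : Compatible x (y :: l)) :
    Compatible x [y] := fun z hz => h z (by simp_all)

theorem insertTree_cons_of_lt (hH : IsHallSet H) {x y : H} {l : List H} (hxy : x < y)
    (hc : Compatible x.1 (y :: l)) :
    insertTree x (y :: l) = insertTree ⟨x.1 * y.1, hH.mul_mem hxy hc.head⟩ l := by
  rw [insertTree, dif_pos]

theorem insertTree_of_decreasing (hH : IsHallSet H) {x : H} {l : List H}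
    (h : Decreasing (x :: l)) : insertTree x l = x :: l := by
  cases l with
  | nil => rfl
  | cons y l =>
    rw [insertTree, dif_neg]
    intro hm
    exact absurd (hH.lt_of_mul_mem hm) (not_lt.2 ((List.pairwise_cons.1 h).1 y (by simp)))

theorem decreasing_cons_cons {x y : H} {l : List H} (hxy : y ≤ x) (h : Decreasing (y :: l)) :
    Decreasing (x :: y :: l) := by
  refine List.pairwise_cons.2 ⟨?_, h⟩
  intro z hz
  rcases List.mem_cons.1 hz with rfl | hz
  · exact hxy
  · exact ((List.pairwise_cons.1 h).1 z hz).trans hxy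

theorem decreasing_concat {l : List H} (hl : Decreasing l) {y : H} (hy : ∀ z ∈ l, y ≤ z) :
    Decreasing (l ++ [y]) :=
  List.pairwise_append.2 ⟨hl, by simp, fun z hz u hu => by
    rw [List.mem_singleton] at hu; subst hu; exact hy z hz⟩

/-- Compatibility survives absorption: the right subtree of `(x,y)` is `y`, which bounds the rest of
the sequence. -/
theorem decreasing_insertTree (hH : IsHallSet H) {x : H} {l : List H} (hl : Decreasing l)
    (hc : Compatible x.1 l) : Decreasing (insertTree x l) := by
  induction l generalizing x with
  | nil => simp [insertTree]
  | cons y l ih =>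
    rcases lt_or_ge x y with hxy | hxy
    · rw [insertTree_cons_of_lt hH hxy hc]
      exact ih hl.of_cons (compatible_mul hl)
    · rw [insertTree_of_decreasing hH (decreasing_cons_cons hxy hl)]
      exact decreasing_cons_cons hxy hl

theorem exists_decreasing (hH : IsHallSet H) (w : FreeMonoid A) :
    ∃ l : List H, Decreasing l ∧ listFoliage l = w := by
  induction w using FreeMonoid.recOn with
  | one => exact ⟨[], by simp, rfl⟩
  | of_mul a w ih =>
    obtain ⟨l, hl, rfl⟩ := ih
    exact ⟨insertTree ⟨_, hH.letter_mem a⟩ l, decreasing_insertTree hH hl (compatible_of a l),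
      listFoliage_insertTree _ _⟩

/-- Every Hall tree is the left comb of a letter and a decreasing sequence of larger Hall trees. -/
theorem IsHallSet.exists_leftComb (hH : IsHallSet H) {h : FreeMagma A} (hh : h ∈ H) :
    ∃ (a : A) (l : List H), Decreasing l ∧ h = leftComb (FreeMagma.of a) l ∧
      (∀ y ∈ l, ⟨h, hh⟩ < y) := by
  induction h with
  | ih1 a => exact ⟨a, [], by simp, rfl, by simp⟩
  | ih2 x y ihx _ =>
    obtain ⟨mx, my, hlt, hxy⟩ := (hH.mul_mem_iff x y).1 hh
    obtain ⟨a, l, hl, e, -⟩ := ihx mx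
    -- The last term of `l` is the right subtree of `x`, so the Hall condition bounds `y` by it,
    -- hence by all of `l`.
    have hy : ∀ z ∈ l, (⟨y, my⟩ : H) ≤ z := by
      induction l using List.reverseRecOn with
      | nil => simp
      | append_singleton l z _ =>
        rw [leftComb_concat] at e
        rcases hxy with ⟨b, rfl⟩ | ⟨x₁, x₂, m, rfl, hle⟩
        · cases e
        · cases e
          intro u hu
          refine hle.trans ?_
          rcases List.mem_append.1 hu with hu | hu
          · exact (List.pairwise_append.1 hl).2.2 u hu _ (by simp)
          · simp_all
    have hlty := hH.mul_lt (y := ⟨y, my⟩) hh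
    refine ⟨a, l ++ [⟨y, my⟩], ?_, ?_, ?_⟩
    · exact decreasing_concat hl hy
    · rw [leftComb_concat, ← e]
    · intro z hz
      rcases List.mem_append.1 hz with hz | hz
      · exact hlty.trans_le (hy z hz)
      · rw [List.mem_singleton] at hz; subst hz; exact hlty

/-- Left subtrees of a Hall tree are Hall trees, so absorption cannot stop before the comb is
complete. -/
theorem insertTree_leftComb (hH : IsHallSet H) {x : H} {l : List H} (hm : leftComb x.1 l ∈ H)
    (l' : List H) : insertTree x (l ++ l') = insertTree ⟨leftComb x.1 l, hm⟩ l' := by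
  induction l using List.reverseRecOn generalizing l' with
  | nil => rfl
  | append_singleton l y ih =>
    have hm' := hm
    rw [leftComb_concat] at hm'
    obtain ⟨m, -⟩ := (hH.mul_mem_iff _ _).1 hm'
    rw [List.append_assoc, ih m, List.singleton_append, insertTree, dif_pos hm']
    simp_rw [leftComb_concat]

/-- Unfold the first tree into its left comb: the terms of the comb exceed that tree, hence all of
`m`, and the concatenation is decreasing. -/
theorem exists_eq_insertTree (hH : IsHallSet H) {x : H} {m : List H}
    (hm : Decreasing (x :: m)) :
    ∃ (a : A) (l : List H), Decreasing l ∧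
      x :: m = insertTree ⟨FreeMagma.of a, hH.letter_mem a⟩ l := by
  obtain ⟨x, hx⟩ := x
  obtain ⟨a, l, hl, rfl, hlt⟩ := hH.exists_leftComb hx
  refine ⟨a, l ++ m, ?_, ?_⟩
  · exact List.pairwise_append.2 ⟨hl, hm.of_cons, fun y hy z hz =>
      ((List.pairwise_cons.1 hm).1 z hz).trans (hlt y hy).le⟩
  · rw [insertTree_leftComb hH (x := ⟨FreeMagma.of a, _⟩) hx, insertTree_of_decreasing hH hm]

theorem decreasing_unique (hH : IsHallSet H) {l m : List H} (hl : Decreasing l)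
    (hm : Decreasing m) (h : listFoliage l = listFoliage m) : l = m := by
  generalize hw : listFoliage m = w at h
  induction w using FreeMonoid.recOn generalizing l m with
  | one => rw [listFoliage_eq_one h, listFoliage_eq_one hw]
  | of_mul a w ih =>
    have key : ∀ k : List H, Decreasing k → listFoliage k = FreeMonoid.of a * w →
        ∃ k', Decreasing k' ∧ listFoliage k' = w ∧
          k = insertTree ⟨FreeMagma.of a, hH.letter_mem a⟩ k' := by
      intro k hk e
      cases k with
      | nil =>
        have := congrArg FreeMonoid.length e
        simp [FreeMonoid.length_mul] at this
        omega
      | cons x k =>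
        obtain ⟨b, k', hk', e'⟩ := exists_eq_insertTree hH hk
        rw [e', listFoliage_insertTree, foliage_of] at e
        obtain ⟨rfl, rfl⟩ := List.cons_eq_cons.1 (congrArg FreeMonoid.toList e)
        exact ⟨k', hk', rfl, e'⟩
    obtain ⟨l', hl', fl, rfl⟩ := key l hl h
    obtain ⟨m', hm', fm, rfl⟩ := key m hm hw
    rw [ih hl' hm' fm fl]

theorem existsUnique_hallFactorization (hH : IsHallSet H) (w : FreeMonoid A) :
    ∃! l : List H, IsHallFactorization H w l := by
  obtain ⟨l, hl, e⟩ := exists_decreasing hH w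
  exact ⟨l, ⟨hl, e⟩, fun m hm => decreasing_unique hH hm.1 hl (hm.2.trans e.symm)⟩

end

/-! ### Words as an orthonormal basis. -/

section

theorem word_one : (word 1 : TensorAlg A) = 1 := rfl

theorem word_of_mul (a : A) (w : FreeMonoid A) : word (FreeMonoid.of a * w) = letter a * word w := by
  simp [word, letter, MonoidAlgebra.single_mul_single]

theorem coeff_word [DecidableEq (FreeMonoid A)] (u v : FreeMonoid A) :
    (word u).coeff v = if u = v then 1 else 0 := by
  rw [word, MonoidAlgebra.coeff_single, Finsupp.single_apply]

theorem basis_eq_word (w : FreeMonoid A) :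
    MonoidAlgebra.basis (FreeMonoid A) ℝ w = word w := by
  rw [MonoidAlgebra.basis_apply]; rfl

/-- The scalar product as a bilinear map. -/
def pairingHom : TensorAlg A →ₗ[ℝ] TensorAlg A →ₗ[ℝ] ℝ :=
  (MonoidAlgebra.basis (FreeMonoid A) ℝ).constr ℝ (MonoidAlgebra.basis (FreeMonoid A) ℝ).coord

theorem pairingHom_apply (x y : TensorAlg A) : pairingHom x y = pairing x y := by
  rw [pairingHom, Module.Basis.constr_apply, Finsupp.sum, LinearMap.sum_apply]
  rfl

theorem pairingHom_word_left (u : FreeMonoid A) (y : TensorAlg A) :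
    pairingHom (word u) y = y.coeff u := by
  rw [pairingHom, ← basis_eq_word, Module.Basis.constr_basis]
  rfl

theorem pairingHom_word_right (x : TensorAlg A) (u : FreeMonoid A) :
    pairingHom x (word u) = x.coeff u := by
  classical
  induction x using MonoidAlgebra.induction_linear with
  | zero => simp
  | add x y hx hy => simp [hx, hy]
  | single v r =>
    have : MonoidAlgebra.single v r = r • word v := by simp [word]
    rw [this, map_smul, LinearMap.smul_apply, pairingHom_word_left, MonoidAlgebra.coeff_smul_apply,
      coeff_word, coeff_word]
    simp [eq_comm]

theorem pairingHom_injective : Function.Injective (pairingHom (A := A)) := by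
  intro x y h
  ext u
  rw [← pairingHom_word_right, h, pairingHom_word_right]

theorem linearMap_ext_word {M : Type*} [AddCommMonoid M] [Module ℝ M] {f g : TensorAlg A →ₗ[ℝ] M}
    (h : ∀ w, f (word w) = g (word w)) : f = g :=
  (MonoidAlgebra.basis (FreeMonoid A) ℝ).ext fun w => by rw [basis_eq_word, h]

theorem linearIndependent_word : LinearIndependent ℝ (word : FreeMonoid A → TensorAlg A) := by
  have := (MonoidAlgebra.basis (FreeMonoid A) ℝ).linearIndependent
  rwa [funext basis_eq_word] at this

theorem span_range_word : Submodule.span ℝ (Set.range (word : FreeMonoid A → TensorAlg A)) = ⊤ := by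
  have := (MonoidAlgebra.basis (FreeMonoid A) ℝ).span_eq
  rwa [funext basis_eq_word] at this

/-! ### Straightening and the Poincaré–Birkhoff–Witt basis. -/

variable [LinearOrder H]

/-- The span of the `P_m` for the decreasing sequences `m` of at least `k` trees satisfying `p`, with
`n` leaves altogether. -/
def pbwSpan (p : H → Prop) (k n : ℕ) : Submodule ℝ (TensorAlg A) :=
  Submodule.span ℝ (pbw '' {m : List H | Decreasing m ∧ (∀ y ∈ m, p y) ∧ k ≤ m.length ∧
    (listFoliage m).length = n})

theorem pbw_mem_pbwSpan {p : H → Prop} {k : ℕ} {m : List H} (hm : Decreasing m)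
    (hp : ∀ y ∈ m, p y) (hk : k ≤ m.length) : pbw m ∈ pbwSpan p k (listFoliage m).length :=
  Submodule.subset_span ⟨m, ⟨hm, hp, hk, rfl⟩, rfl⟩

/-- As the trees involved are at most `y`, prefixing `y` needs no reordering and adds one factor. -/
theorem bracket_mul_mem_pbwSpan {b y : H} (hy : y ≤ b) {k n : ℕ} {x : TensorAlg A}
    (hx : x ∈ pbwSpan (· ≤ y) k n) :
    bracket y.1 * x ∈ pbwSpan (· ≤ b) (k + 1) ((foliage y.1).length + n) := by
  induction hx using Submodule.span_induction with
  | mem x hx =>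
    obtain ⟨m, ⟨hm, hp, hk, rfl⟩, rfl⟩ := hx
    rw [← pbw_cons, ← FreeMonoid.length_mul, ← listFoliage_cons]
    refine pbw_mem_pbwSpan (List.pairwise_cons.2 ⟨hp, hm⟩) ?_ (by simpa using hk)
    intro z hz
    rcases List.mem_cons.1 hz with rfl | hz
    · exact hy
    · exact (hp z hz).trans hy
  | zero => simp
  | add x y _ _ hx hy => rw [mul_add]; exact add_mem hx hy
  | smul c x _ hx => rw [mul_smul_comm]; exact Submodule.smul_mem _ _ hx

theorem pbwSpan_mono {p q : H → Prop} (hpq : ∀ y, p y → q y) {k k' n : ℕ} (hk : k' ≤ k) :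
    pbwSpan p k n ≤ pbwSpan q k' n := by
  apply Submodule.span_mono
  apply Set.image_mono
  rintro m ⟨h₁, h₂, h₃, h₄⟩
  exact ⟨h₁, fun y hy => hpq y (h₂ y hy), hk.trans h₃, h₄⟩

/-- By ancestrality `(x,y) < y`, so absorption never exceeds the bound. -/
theorem le_of_mem_insertTree (hH : IsHallSet H) {b x : H} {l : List H} (hx : x ≤ b)
    (hl : ∀ y ∈ l, y ≤ b) : ∀ y ∈ insertTree x l, y ≤ b := by
  induction l generalizing x with
  | nil => simpa [insertTree] using hx
  | cons y l ih =>
    unfold insertTree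
    split_ifs with h
    · exact ih ((hH.mul_lt h).le.trans (hl y (by simp))) fun z hz => hl z (by simp [hz])
    · intro z hz
      rcases List.mem_cons.1 hz with rfl | hz
      · exact hx
      · exact hl z hz

/-- For `x < y`, write `xy = [x,y] + yx`. The first term is the next absorption step; the second is
straightened behind `y` and contributes only products with at least two factors. -/
theorem bracket_mul_pbw_sub_mem (hH : IsHallSet H) {b x : H} {l : List H} (hl : Decreasing l)
    (hc : Compatible x.1 l) (hx : x ≤ b) (hlb : ∀ y ∈ l, y ≤ b) :
    bracket x.1 * pbw l - pbw (insertTree x l) ∈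
      pbwSpan (· ≤ b) 2 ((foliage x.1).length + (listFoliage l).length) := by
  induction l generalizing x b with
  | nil => simp [insertTree]
  | cons y l ih =>
    rcases lt_or_ge x y with hxy | hxy
    · have hyb := hlb y (by simp)
      have hly := (List.pairwise_cons.1 hl).1
      have h₁ := ih (x := ⟨x.1 * y.1, hH.mul_mem hxy hc.head⟩) (b := b) hl.of_cons
        (compatible_mul hl) ((hH.mul_lt _).le.trans hyb) (fun z hz => hlb z (by simp [hz]))
      -- The bound is sharpened from `b` to `y`, so that `y` can be put in front afterwards.
      have h₂ := ih (x := x) (b := y) hl.of_cons hc.of_cons hxy.le hly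
      have h₃ := pbw_mem_pbwSpan (p := (· ≤ y)) (k := 1) (decreasing_insertTree hH hl.of_cons hc.of_cons)
        (le_of_mem_insertTree hH hxy.le hly)
        (List.length_pos_iff.2 (insertTree_ne_nil x l))
      rw [listFoliage_insertTree, FreeMonoid.length_mul] at h₃
      have h₄ := bracket_mul_mem_pbwSpan hyb
        (add_mem (pbwSpan_mono (fun _ h => h) one_le_two h₂) h₃)
      rw [insertTree_cons_of_lt hH hxy hc]
      have e : bracket x.1 * pbw (y :: l) - pbw (insertTree ⟨x.1 * y.1, hH.mul_mem hxy hc.head⟩ l) =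
          (bracket (x.1 * y.1) * pbw l - pbw (insertTree ⟨x.1 * y.1, hH.mul_mem hxy hc.head⟩ l)) +
          bracket y.1 * (bracket x.1 * pbw l - pbw (insertTree x l) + pbw (insertTree x l)) := by
        rw [pbw_cons, bracket_mul]; noncomm_ring
      rw [e]
      refine add_mem ?_ ?_
      · simpa [FreeMonoid.length_mul, add_assoc] using h₁
      · simpa [FreeMonoid.length_mul, add_left_comm] using h₄
    · rw [insertTree_of_decreasing hH (decreasing_cons_cons hxy hl)]
      simp

theorem letter_mul_pbw_sub_mem (hH : IsHallSet H) (a : A) {l : List H} (hl : Decreasing l) :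
    letter a * pbw l - pbw (insertTree ⟨FreeMagma.of a, hH.letter_mem a⟩ l) ∈
      pbwSpan (fun _ : H => True) 2 (1 + (listFoliage l).length) := by
  obtain ⟨b, hb, hlb⟩ : ∃ b : H, ⟨FreeMagma.of a, hH.letter_mem a⟩ ≤ b ∧ ∀ y ∈ l, y ≤ b := by
    cases l with
    | nil => exact ⟨_, le_rfl, by simp⟩
    | cons y l =>
      refine ⟨_, le_max_left _ y, fun z hz => le_trans ?_ (le_max_right _ y)⟩
      rcases List.mem_cons.1 hz with rfl | hz
      · exact le_rfl
      · exact (List.pairwise_cons.1 hl).1 z hz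
  have h := bracket_mul_pbw_sub_mem hH hl (compatible_of a l) hb hlb
  rw [foliage_of, FreeMonoid.length_of, bracket_of] at h
  exact pbwSpan_mono (fun _ _ => trivial) le_rfl h

theorem letter_mul_mem_pbwSpan (hH : IsHallSet H) (a : A) {n : ℕ} {x : TensorAlg A}
    (hx : x ∈ pbwSpan (fun _ : H => True) 0 n) :
    letter a * x ∈ pbwSpan (fun _ : H => True) 0 (1 + n) := by
  induction hx using Submodule.span_induction with
  | mem x hx =>
    obtain ⟨m, ⟨hm, -, -, rfl⟩, rfl⟩ := hx
    have h₁ := pbwSpan_mono (fun _ h => h) (Nat.zero_le 2) (letter_mul_pbw_sub_mem hH a hm)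
    have h₂ := pbw_mem_pbwSpan (p := fun _ => True) (k := 0)
      (decreasing_insertTree hH hm (x := ⟨_, hH.letter_mem a⟩) (compatible_of a m))
      (by simp) (Nat.zero_le _)
    rw [listFoliage_insertTree, FreeMonoid.length_mul] at h₂
    simpa using add_mem h₁ h₂
  | zero => simp
  | add x y _ _ hx hy => rw [mul_add]; exact add_mem hx hy
  | smul c x _ hx => rw [mul_smul_comm]; exact Submodule.smul_mem _ _ hx

theorem word_mem_pbwSpan (hH : IsHallSet H) (w : FreeMonoid A) :
    word w ∈ pbwSpan (fun _ : H => True) 0 w.length := by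
  induction w using FreeMonoid.recOn with
  | one => exact pbw_mem_pbwSpan (m := []) (by simp) (by simp) le_rfl
  | of_mul a w ih =>
    rw [word_of_mul, FreeMonoid.length_mul]
    exact letter_mul_mem_pbwSpan hH a ih

/-- The decreasing sequence of Hall trees with foliage `w`. -/
def hallFactorization (hH : IsHallSet H) (w : FreeMonoid A) : List H :=
  (exists_decreasing hH w).choose

theorem decreasing_hallFactorization (hH : IsHallSet H) (w : FreeMonoid A) :
    Decreasing (hallFactorization hH w) :=
  (exists_decreasing hH w).choose_spec.1

theorem listFoliage_hallFactorization (hH : IsHallSet H) (w : FreeMonoid A) :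
    listFoliage (hallFactorization hH w) = w :=
  (exists_decreasing hH w).choose_spec.2

theorem hallFactorization_eq (hH : IsHallSet H) {l : List H} (hl : Decreasing l) :
    hallFactorization hH (listFoliage l) = l :=
  decreasing_unique hH (decreasing_hallFactorization hH _) hl (listFoliage_hallFactorization hH _)

theorem pbwSpan_le (hH : IsHallSet H) (n : ℕ) : pbwSpan (fun _ : H => True) 0 n ≤
    Submodule.span ℝ ((fun w => pbw (hallFactorization hH w)) '' {w | w.length = n}) := by
  apply Submodule.span_mono
  rintro _ ⟨m, ⟨hm, -, -, rfl⟩, rfl⟩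
  exact ⟨listFoliage m, rfl, by simp only [hallFactorization_eq hH hm]⟩

theorem top_le_span_pbw (hH : IsHallSet H) :
    ⊤ ≤ Submodule.span ℝ (Set.range fun w => pbw (hallFactorization hH w)) := by
  rw [← span_range_word, Submodule.span_le]
  rintro _ ⟨w, rfl⟩
  exact Submodule.span_mono (Set.image_subset_range _ _) (pbwSpan_le hH _ (word_mem_pbwSpan hH w))

/-- Up to length `N` there are as many PBW elements as words, and they span these finitely many
independent words. -/
theorem linearIndependent_pbw [Finite A] (hH : IsHallSet H) :
    LinearIndependent ℝ fun w => pbw (hallFactorization hH w) := by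
  have key (N : ℕ) : LinearIndepOn ℝ (fun w => pbw (hallFactorization hH w))
      {w : FreeMonoid A | w.length ≤ N} := by
    have hfin : Finite {w : FreeMonoid A | w.length ≤ N} := List.finite_length_le A N
    have := Fintype.ofFinite {w : FreeMonoid A | w.length ≤ N}
    refine linearIndependent_iff_card_le_finrank_span.2 ?_
    have hli : LinearIndependent ℝ fun w : {w : FreeMonoid A | w.length ≤ N} => word w.1 :=
      linearIndependent_word.comp _ Subtype.val_injective
    rw [← finrank_span_eq_card hli]
    have : Module.Finite ℝ (Submodule.span ℝ (Set.range fun w : {w : FreeMonoid A | w.length ≤ N} =>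
        pbw (hallFactorization hH w.1))) := FiniteDimensional.span_of_finite ℝ (Set.finite_range _)
    refine Submodule.finrank_mono ?_
    rw [Submodule.span_le]
    rintro _ ⟨w, rfl⟩
    refine Submodule.span_mono ?_ (pbwSpan_le hH _ (word_mem_pbwSpan hH w.1))
    rintro _ ⟨u, hu, rfl⟩
    exact ⟨⟨u, (le_of_eq hu).trans w.2⟩, rfl⟩
  rw [← linearIndepOn_univ_iff]
  refine linearIndepOn_of_finite _ fun t _ ht => ?_
  obtain ⟨N, hN⟩ := (ht.image FreeMonoid.length).bddAbove
  exact (key N).mono fun w hw => hN ⟨w, hw, rfl⟩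

/-! ### The dual basis. -/

variable [Finite A]

/-- The Poincaré-Birkhoff-Witt basis of a Hall set. -/
def pbwBasis (hH : IsHallSet H) : Module.Basis (FreeMonoid A) ℝ (TensorAlg A) :=
  .mk (linearIndependent_pbw hH) (top_le_span_pbw hH)

theorem pbwBasis_apply (hH : IsHallSet H) (w : FreeMonoid A) :
    pbwBasis hH w = pbw (hallFactorization hH w) := by
  simp [pbwBasis]

theorem pbwBasis_listFoliage (hH : IsHallSet H) {l : List H} (hl : Decreasing l) :
    pbwBasis hH (listFoliage l) = pbw l := by
  rw [pbwBasis_apply, hallFactorization_eq hH hl]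

theorem coord_pbw [DecidableEq (FreeMonoid A)] (hH : IsHallSet H) (w : FreeMonoid A) {l : List H}
    (hl : Decreasing l) :
    (pbwBasis hH).coord w (pbw l) = if w = listFoliage l then 1 else 0 := by
  rw [← pbwBasis_listFoliage hH hl, Module.Basis.coord_apply, Module.Basis.repr_self,
    Finsupp.single_apply]
  simp only [eq_comm]

/-- Straightening preserves length; this is what makes each coordinate form a pairing with a finite
sum of words. -/
theorem coord_word_of_length_ne (hH : IsHallSet H) {w u : FreeMonoid A}
    (h : u.length ≠ w.length) : (pbwBasis hH).coord w (word u) = 0 := by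
  classical
  have : pbwSpan (fun _ : H => True) 0 u.length ≤ LinearMap.ker ((pbwBasis hH).coord w) := by
    rw [pbwSpan, Submodule.span_le]
    rintro _ ⟨m, ⟨hm, -, -, hu⟩, rfl⟩
    rw [SetLike.mem_coe, LinearMap.mem_ker, coord_pbw hH w hm, if_neg]
    rintro rfl
    exact h hu.symm
  exact this (word_mem_pbwSpan hH u)

/-- The dual basis of the Poincaré-Birkhoff-Witt basis. -/
def dualPBW (hH : IsHallSet H) (w : FreeMonoid A) : TensorAlg A :=
  ∑ u ∈ (List.finite_length_eq A w.length).toFinset,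
    (pbwBasis hH).coord w (word (FreeMonoid.ofList u)) • word (FreeMonoid.ofList u)

theorem pairingHom_dualPBW (hH : IsHallSet H) (w : FreeMonoid A) :
    pairingHom (dualPBW hH w) = (pbwBasis hH).coord w := by
  classical
  refine linearMap_ext_word fun u => ?_
  rw [dualPBW, map_sum, LinearMap.sum_apply, Finset.sum_eq_single (FreeMonoid.toList u)]
  · simp [pairingHom_word_left, coeff_word]
  · intro v _ hv
    rw [map_smul, LinearMap.smul_apply, pairingHom_word_left, coeff_word, if_neg, smul_zero]
    rintro e
    exact hv (by rw [e]; rfl)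
  · intro h
    rw [FreeMonoid.ofList_toList, coord_word_of_length_ne hH, zero_smul, map_zero,
      LinearMap.zero_apply]
    intro e
    exact h ((Set.Finite.mem_toFinset _).2 e)

theorem isDualPBW_dualPBW (hH : IsHallSet H) : IsDualPBW H (dualPBW hH) := by
  classical
  rintro w u l ⟨hl, rfl⟩
  rw [← pairingHom_apply, pairingHom_dualPBW, coord_pbw hH w hl]
  exact ⟨fun h => if_pos h, fun h => if_neg h⟩

theorem IsDualPBW.eq_dualPBW (hH : IsHallSet H) {S : FreeMonoid A → TensorAlg A}
    (hS : IsDualPBW H S) : S = dualPBW hH := by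
  classical
  funext w
  apply pairingHom_injective
  refine (pbwBasis hH).ext fun u => ?_
  have hu := decreasing_hallFactorization hH u
  have e := listFoliage_hallFactorization hH u
  obtain ⟨h₁, h₂⟩ := hS w u _ ⟨hu, e⟩
  rw [pairingHom_dualPBW, pbwBasis_apply, coord_pbw hH w hu, e, pairingHom_apply]
  split_ifs with h
  · exact h₁ h
  · exact h₂ h

end

/-! ### Shuffle, half shuffle and the coproduct dual to the shuffle. -/

section

theorem word_induction {p : TensorAlg A → Prop} (zero : p 0)
    (add : ∀ x y, p x → p y → p (x + y)) (smul : ∀ (c : ℝ) (x), p x → p (c • x))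
    (wd : ∀ w, p (word w)) (x : TensorAlg A) : p x := by
  induction x using MonoidAlgebra.induction_linear with
  | zero => exact zero
  | add x y hx hy => exact add x y hx hy
  | single v r =>
    have : MonoidAlgebra.single v r = r • word v := by simp [word]
    rw [this]
    exact smul r _ (wd v)

theorem of_mul_eq_of_mul {a b : A} {u v : FreeMonoid A} :
    FreeMonoid.of a * u = FreeMonoid.of b * v ↔ a = b ∧ u = v := by
  refine ⟨fun h => ?_, fun h => by rw [h.1, h.2]⟩
  exact List.cons_eq_cons.1 (congrArg FreeMonoid.toList h)

theorem of_mul_ne_one (a : A) (u : FreeMonoid A) : FreeMonoid.of a * u ≠ 1 := by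
  intro h
  have := congrArg FreeMonoid.length h
  simp [FreeMonoid.length_mul] at this

theorem coeff_letter_mul_one (a : A) (x : TensorAlg A) : (letter a * x).coeff 1 = 0 := by
  classical
  induction x using word_induction with
  | zero => simp
  | add x y hx hy => simp [mul_add, hx, hy]
  | smul c x hx => simp [hx]
  | wd w => rw [← word_of_mul, coeff_word, if_neg (of_mul_ne_one a w)]

theorem coeff_letter_mul [DecidableEq A] (a b : A) (x : TensorAlg A) (u : FreeMonoid A) :
    (letter a * x).coeff (FreeMonoid.of b * u) = if a = b then x.coeff u else 0 := by
  classical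
  induction x using word_induction with
  | zero => simp
  | add x y hx hy => simp only [mul_add, MonoidAlgebra.coeff_add, Finsupp.add_apply, hx, hy]; split_ifs <;> simp
  | smul c x hx => simp [hx]
  | wd w =>
    rw [← word_of_mul, coeff_word, coeff_word]
    simp only [of_mul_eq_of_mul]
    split_ifs <;> simp_all

/-- The shuffle product of two words. -/
def shuffleWord (u v : List A) : TensorAlg A :=
  -- Since `e ≺ e = 0`, symmetrizing `≺` misses the unit, which is prescribed separately.
  if u = [] ∧ v = [] then 1 else halfShuffleWord u v + halfShuffleWord v u

theorem halfShuffleWord_nil_left (v : List A) : halfShuffleWord [] v = 0 := by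
  rw [halfShuffleWord]

theorem halfShuffleWord_nil_right (u : List A) (hu : u ≠ []) :
    halfShuffleWord u [] = word (FreeMonoid.ofList u) := by
  cases u with
  | nil => exact absurd rfl hu
  | cons a u => rw [halfShuffleWord]

theorem shuffleWord_nil_right (u : List A) : shuffleWord u [] = word (FreeMonoid.ofList u) := by
  unfold shuffleWord
  split_ifs with h
  · rw [h.1]; rfl
  · rw [halfShuffleWord_nil_left, halfShuffleWord_nil_right u (by simpa using h), add_zero]

theorem shuffleWord_comm (u v : List A) : shuffleWord u v = shuffleWord v u := by
  unfold shuffleWord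
  simp only [and_comm, add_comm]

theorem halfShuffleWord_cons (a : A) (u v : List A) :
    halfShuffleWord (a :: u) v = letter a * shuffleWord u v := by
  cases v with
  | nil =>
    rw [halfShuffleWord_nil_right _ (by simp), shuffleWord_nil_right, ← word_of_mul]
    rfl
  | cons b v =>
    rw [halfShuffleWord, shuffleWord, if_neg (by simp)]

theorem shuffleWord_nil_left (u : List A) : shuffleWord [] u = word (FreeMonoid.ofList u) := by
  rw [shuffleWord_comm, shuffleWord_nil_right]

theorem shuffleWord_cons_cons (a b : A) (u v : List A) :
    shuffleWord (a :: u) (b :: v) =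
      letter a * shuffleWord u (b :: v) + letter b * shuffleWord (a :: u) v := by
  rw [shuffleWord, if_neg (by simp), halfShuffleWord_cons, halfShuffleWord_cons,
    shuffleWord_comm v]

/-- The shuffle product. -/
def shuffle : TensorAlg A →ₗ[ℝ] TensorAlg A →ₗ[ℝ] TensorAlg A :=
  (MonoidAlgebra.basis (FreeMonoid A) ℝ).constr ℝ fun u =>
    (MonoidAlgebra.basis (FreeMonoid A) ℝ).constr ℝ fun v =>
      shuffleWord u.toList v.toList

theorem shuffle_word (u v : FreeMonoid A) :
    shuffle (word u) (word v) = shuffleWord u.toList v.toList := by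
  rw [shuffle, ← basis_eq_word, ← basis_eq_word, Module.Basis.constr_basis,
    Module.Basis.constr_basis]

theorem halfShuffle_word (u v : FreeMonoid A) :
    halfShuffle (word u) (word v) = halfShuffleWord u.toList v.toList := by
  rw [halfShuffle, ← basis_eq_word, ← basis_eq_word, Module.Basis.constr_basis,
    Module.Basis.constr_basis]

theorem halfShuffle_letter_mul (a : A) (x y : TensorAlg A) :
    halfShuffle (letter a * x) y = letter a * shuffle x y := by
  induction x using word_induction with
  | zero => simp
  | add x x' hx hx' => simp [mul_add, hx, hx']
  | smul c x hx => simp [hx]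
  | wd u =>
    induction y using word_induction with
    | zero => simp
    | add y y' hy hy' => simp [mul_add, hy, hy']
    | smul c y hy => simp [hy]
    | wd v =>
      rw [← word_of_mul, halfShuffle_word, shuffle_word]
      exact halfShuffleWord_cons a _ _

/-- The coproduct for which the letters are primitive. -/
def coproduct : TensorAlg A →ₐ[ℝ] TensorAlg A ⊗[ℝ] TensorAlg A :=
  MonoidAlgebra.lift ℝ _ _ (FreeMonoid.lift fun a => letter a ⊗ₜ[ℝ] 1 + 1 ⊗ₜ[ℝ] letter a)

theorem coproduct_letter (a : A) : coproduct (letter a) = letter a ⊗ₜ[ℝ] 1 + 1 ⊗ₜ[ℝ] letter a := by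
  simp [coproduct, letter, word, MonoidAlgebra.lift_single]

/-- A commutator of primitive elements is primitive: the mixed terms cancel. -/
theorem coproduct_bracket (t : FreeMagma A) :
    coproduct (bracket t) = bracket t ⊗ₜ[ℝ] 1 + 1 ⊗ₜ[ℝ] bracket t := by
  induction t with
  | ih1 a => exact coproduct_letter a
  | ih2 x y hx hy =>
    rw [bracket_mul, map_sub, map_mul, map_mul, hx, hy]
    simp only [mul_add, add_mul, Algebra.TensorProduct.tmul_mul_tmul, mul_one, one_mul,
      TensorProduct.sub_tmul, TensorProduct.tmul_sub]
    abel

/-- Contraction of the right factor of a tensor product with a linear form. -/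
def contract (φ : TensorAlg A →ₗ[ℝ] ℝ) : TensorAlg A ⊗[ℝ] TensorAlg A →ₗ[ℝ] TensorAlg A :=
  (TensorProduct.rid ℝ (TensorAlg A)).toLinearMap ∘ₗ φ.lTensor (TensorAlg A)

@[simp] theorem contract_tmul (φ : TensorAlg A →ₗ[ℝ] ℝ) (x y : TensorAlg A) :
    contract φ (x ⊗ₜ[ℝ] y) = φ y • x := by
  simp [contract]

theorem contract_primitive_mul (φ : TensorAlg A →ₗ[ℝ] ℝ) (x : TensorAlg A)
    (t : TensorAlg A ⊗[ℝ] TensorAlg A) :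
    contract φ ((x ⊗ₜ[ℝ] 1 + 1 ⊗ₜ[ℝ] x) * t) =
      x * contract φ t + contract (φ ∘ₗ LinearMap.mulLeft ℝ x) t := by
  induction t with
  | zero => simp
  | add t t' h h' => simp only [mul_add, map_add, h, h']; abel
  | tmul y z => simp [add_mul]

theorem contract_add (φ ψ : TensorAlg A →ₗ[ℝ] ℝ) (t : TensorAlg A ⊗[ℝ] TensorAlg A) :
    contract (φ + ψ) t = contract φ t + contract ψ t := by
  simp [contract, LinearMap.lTensor_add]

theorem contract_smul (c : ℝ) (φ : TensorAlg A →ₗ[ℝ] ℝ) (t : TensorAlg A ⊗[ℝ] TensorAlg A) :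
    contract (c • φ) t = c • contract φ t := by
  simp [contract, LinearMap.lTensor_smul]

theorem contract_zero (t : TensorAlg A ⊗[ℝ] TensorAlg A) :
    contract (0 : TensorAlg A →ₗ[ℝ] ℝ) t = 0 := by
  simp [contract]

theorem pairingHom_word_comp_mulLeft_nil (a : A) :
    pairingHom (word 1) ∘ₗ LinearMap.mulLeft ℝ (letter a) = 0 := by
  refine LinearMap.ext fun x => ?_
  simp [pairingHom_word_left, coeff_letter_mul_one]

theorem pairingHom_word_comp_mulLeft_cons [DecidableEq A] (a b : A) (v : FreeMonoid A) :
    pairingHom (word (FreeMonoid.of b * v)) ∘ₗ LinearMap.mulLeft ℝ (letter a) =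
      if a = b then pairingHom (word v) else 0 := by
  refine LinearMap.ext fun x => ?_
  split_ifs with h <;> simp [pairingHom_word_left, coeff_letter_mul, h]

/-- Both sides obey the same recursion: the first letter of `w` comes either from `u` or from `v`.
-/
theorem coeff_shuffleWord (u v w : FreeMonoid A) :
    (shuffleWord u.toList v.toList).coeff w =
      (contract (pairingHom (word v)) (coproduct (word w))).coeff u := by
  classical
  induction w using FreeMonoid.recOn generalizing u v with
  | one =>
    rw [word_one, map_one (coproduct (A := A)), Algebra.TensorProduct.one_def, contract_tmul,
      ← word_one, pairingHom_word_left, MonoidAlgebra.coeff_smul_apply, coeff_word, coeff_word]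
    cases u using FreeMonoid.casesOn with
    | one =>
      rw [FreeMonoid.toList_one, shuffleWord_nil_left, FreeMonoid.ofList_toList, coeff_word]
      simp [eq_comm]
    | of_mul a u =>
      rw [if_neg (of_mul_ne_one a u).symm, smul_zero]
      cases v using FreeMonoid.casesOn with
      | one =>
        rw [FreeMonoid.toList_one, shuffleWord_nil_right, FreeMonoid.ofList_toList, coeff_word,
          if_neg (of_mul_ne_one a u)]
      | of_mul b v =>
        simp [shuffleWord_cons_cons, coeff_letter_mul_one]
  | of_mul c w ih =>
    rw [word_of_mul, map_mul (coproduct (A := A)), coproduct_letter, contract_primitive_mul,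
      MonoidAlgebra.coeff_add, Finsupp.add_apply]
    cases u using FreeMonoid.casesOn with
    | one =>
      rw [FreeMonoid.toList_one, shuffleWord_nil_left, FreeMonoid.ofList_toList,
        coeff_letter_mul_one, zero_add]
      cases v using FreeMonoid.casesOn with
      | one =>
        rw [pairingHom_word_comp_mulLeft_nil, contract_zero, coeff_word,
          if_neg (of_mul_ne_one c w).symm]
        rfl
      | of_mul b v =>
        rw [pairingHom_word_comp_mulLeft_cons, word_of_mul, coeff_letter_mul]
        by_cases h : c = b
        · rw [if_pos h, if_pos h.symm, ← ih, FreeMonoid.toList_one, shuffleWord_nil_left,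
            FreeMonoid.ofList_toList]
        · rw [if_neg h, if_neg (Ne.symm h), contract_zero]
          rfl
    | of_mul a u =>
      rw [coeff_letter_mul]
      cases v using FreeMonoid.casesOn with
      | one =>
        rw [pairingHom_word_comp_mulLeft_nil, contract_zero, ← ih, FreeMonoid.toList_one,
          shuffleWord_nil_right, shuffleWord_nil_right, FreeMonoid.ofList_toList,
          FreeMonoid.ofList_toList, word_of_mul, coeff_letter_mul, MonoidAlgebra.coeff_zero,
          Finsupp.zero_apply, add_zero]
        simp only [eq_comm]
      | of_mul b v =>
        rw [pairingHom_word_comp_mulLeft_cons, FreeMonoid.toList_of_mul, FreeMonoid.toList_of_mul,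
          shuffleWord_cons_cons, MonoidAlgebra.coeff_add, Finsupp.add_apply, coeff_letter_mul,
          coeff_letter_mul, ← ih, FreeMonoid.toList_of_mul, ← FreeMonoid.toList_of_mul a u]
        congr 1
        · simp only [eq_comm]
        · by_cases h : c = b
          · rw [if_pos h, if_pos h.symm, ih]
          · rw [if_neg h, if_neg (Ne.symm h), contract_zero]
            rfl

theorem pairingHom_shuffle (x y p : TensorAlg A) :
    pairingHom (shuffle x y) p = pairingHom x (contract (pairingHom y) (coproduct p)) := by
  induction x using word_induction with
  | zero => simp
  | add x x' hx hx' => simp [hx, hx']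
  | smul c x hx => simp [hx]
  | wd u =>
    induction y using word_induction with
    | zero => simp [contract_zero]
    | add y y' hy hy' => simp [contract_add, hy, hy']
    | smul c y hy => simp [contract_smul, hy]
    | wd v =>
      induction p using word_induction with
      | zero => simp
      | add p p' hp hp' => simp only [map_add, hp, hp']
      | smul c p hp => simp only [map_smul, hp]
      | wd w => rw [shuffle_word, pairingHom_word_right, coeff_shuffleWord, pairingHom_word_left]

/-- The coproduct of a product of primitives distributes the factors over the two sides; the form
sees a sublist, and only the empty one survives. -/
theorem contract_coproduct_pbw_of_sublist (φ : TensorAlg A →ₗ[ℝ] ℝ) (l : List H)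
    (hφ : ∀ m : List H, m.Sublist l → m ≠ [] → φ (pbw m) = 0) :
    contract φ (coproduct (pbw l)) = φ 1 • pbw l := by
  induction l generalizing φ with
  | nil => simp [Algebra.TensorProduct.one_def]
  | cons h l ih =>
    rw [pbw_cons, map_mul, coproduct_bracket, contract_primitive_mul,
      ih φ fun m hm => hφ m (hm.cons _), ih]
    · have := hφ [h] (by simp) (by simp)
      simp at this
      simp [this]
    · intro m hm _
      simpa using hφ (h :: m) (hm.cons_cons _) (by simp)

/-- If the factor `h` goes to the right, the hypothesis forces all other factors to the left. -/
theorem contract_coproduct_pbw_cons (φ : TensorAlg A →ₗ[ℝ] ℝ) (h : H) (l : List H)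
    (hφ : ∀ m : List H, m.Sublist l → m ≠ [] → φ (pbw (h :: m)) = 0) :
    contract φ (coproduct (pbw (h :: l))) =
      bracket h.1 * contract φ (coproduct (pbw l)) + φ (bracket h.1) • pbw l := by
  rw [pbw_cons, map_mul, coproduct_bracket, contract_primitive_mul,
    contract_coproduct_pbw_of_sublist (φ ∘ₗ LinearMap.mulLeft ℝ (bracket h.1)) l]
  · simp
  · intro m hm hne
    simpa using hφ m hm hne

theorem listFoliage_singleton (h : H) : listFoliage [h] = foliage h.1 := by simp

/-- In a decreasing sequence bounded below by `y`, all copies of `y` sit at the end, so the final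
run of the comb contains every one. -/
theorem rightMultiplicity_leftComb [LinearOrder H] (a : A) {l : List H}
    (hl : Decreasing l) {y : H} (hy : ∀ z ∈ l, y ≤ z) :
    rightMultiplicity y.1 (leftComb (FreeMagma.of a) l) = l.count y := by
  induction l using List.reverseRecOn with
  | nil => rfl
  | append_singleton l z ih =>
    have hp := List.pairwise_append.1 hl
    rw [leftComb_concat]
    by_cases h : z = y
    · subst h
      refine (if_pos rfl).trans ?_
      rw [ih hp.1 fun u hu => hy u (by simp [hu])]
      simp
    · refine (if_neg fun e => h (Subtype.ext e)).trans ?_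
      refine (List.count_eq_zero.2 fun hm => h ?_).symm
      rcases List.mem_append.1 hm with hm | hm
      · exact le_antisymm (hp.2.2 y hm z (by simp)) (hy z (by simp))
      · simp_all

end

/-! ### Dual basis elements of Hall words. -/

section

variable [LinearOrder H] [Finite A]

theorem coord_foliage_eq_zero (hH : IsHallSet H) (h : H) {l : List H} (hl : Decreasing l)
    (h₂ : 2 ≤ l.length) : (pbwBasis hH).coord (foliage h.1) (pbw l) = 0 := by
  classical
  rw [coord_pbw hH _ hl, if_neg]
  intro e
  rw [← listFoliage_singleton] at e
  rw [← decreasing_unique hH (by simp) hl e] at h₂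
  simp at h₂

/-- On a PBW element `P_u`, the product `b P_u` is `P_{bu}` up to terms with at least two factors,
which the coordinate of a Hall word kills. -/
theorem coord_letter_mul (hH : IsHallSet H) [DecidableEq A] {h : H} {a : A} {v : FreeMonoid A}
    (hv : foliage h.1 = FreeMonoid.of a * v) (b : A) (x : TensorAlg A) :
    (pbwBasis hH).coord (foliage h.1) (letter b * x) =
      if a = b then (pbwBasis hH).coord v x else 0 := by
  classical
  suffices (pbwBasis hH).coord (foliage h.1) ∘ₗ LinearMap.mulLeft ℝ (letter b) =
      if a = b then (pbwBasis hH).coord v else 0 by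
    have := LinearMap.congr_fun this x
    split_ifs at this ⊢ <;> simpa using this
  refine (pbwBasis hH).ext fun u => ?_
  have hu := decreasing_hallFactorization hH u
  have e := listFoliage_hallFactorization hH u
  rw [pbwBasis_apply]
  have hker : pbwSpan (fun _ : H => True) 2 (1 + (listFoliage (hallFactorization hH u)).length) ≤
      LinearMap.ker ((pbwBasis hH).coord (foliage h.1)) := by
    rw [pbwSpan, Submodule.span_le]
    rintro _ ⟨m, ⟨hm, -, hk, -⟩, rfl⟩
    exact coord_foliage_eq_zero hH h hm hk
  have h₁ := hker (letter_mul_pbw_sub_mem hH b hu)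
  rw [LinearMap.mem_ker, map_sub, sub_eq_zero, coord_pbw hH _ (decreasing_insertTree hH hu
    (compatible_of b _)), listFoliage_insertTree, foliage_of, e, hv] at h₁
  rw [LinearMap.comp_apply, LinearMap.mulLeft_apply, hv, h₁]
  simp only [of_mul_eq_of_mul]
  by_cases hab : a = b
  · simp only [hab, true_and, if_true]
    rw [coord_pbw hH _ hu, e]
  · simp [hab]

theorem dualPBW_one (hH : IsHallSet H) : dualPBW hH 1 = 1 := by
  classical
  apply pairingHom_injective
  refine linearMap_ext_word fun u => ?_
  rw [pairingHom_dualPBW, ← word_one, pairingHom_word_left, coeff_word]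
  split_ifs with h
  · subst h
    have := coord_pbw hH 1 (l := []) (by simp)
    simpa [← word_one] using this
  · exact coord_word_of_length_ne hH fun e => h (FreeMonoid.length_eq_zero.1 e)

theorem dualPBW_foliage (hH : IsHallSet H) {h : H} {a : A} {v : FreeMonoid A}
    (hv : foliage h.1 = FreeMonoid.of a * v) :
    dualPBW hH (foliage h.1) = letter a * dualPBW hH v := by
  classical
  apply pairingHom_injective
  refine linearMap_ext_word fun u => ?_
  rw [pairingHom_word_right (letter a * _)]
  cases u using FreeMonoid.casesOn with
  | one =>
    rw [coeff_letter_mul_one, pairingHom_dualPBW]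
    refine coord_word_of_length_ne hH fun e => foliage_ne_one h.1 (FreeMonoid.length_eq_zero.1 ?_)
    rw [← e, FreeMonoid.length_one]
  | of_mul b u =>
    rw [coeff_letter_mul, word_of_mul, pairingHom_dualPBW, coord_letter_mul hH hv,
      ← pairingHom_word_right, pairingHom_dualPBW]

/-- The coordinate of `f(h)` vanishes on longer PBW products, so exactly one copy of `[h]` moves to
the right: the formal derivative of a monomial. -/
theorem contract_coord_foliage (hH : IsHallSet H) (h : H) {l : List H} (hl : Decreasing l) :
    contract ((pbwBasis hH).coord (foliage h.1)) (coproduct (pbw l)) =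
      (l.count h : ℝ) • pbw (l.erase h) := by
  have : DecidableEq (FreeMonoid A) := Classical.decEq _
  induction l with
  | nil =>
    have := coord_pbw hH (foliage h.1) (l := []) (by simp)
    rw [listFoliage_nil, if_neg (foliage_ne_one _)] at this
    rw [pbw_nil, map_one (coproduct (A := A)), Algebra.TensorProduct.one_def, contract_tmul,
      ← pbw_nil (H := H), this]
    simp
  | cons x l ih =>
    have hx := coord_pbw hH (foliage h.1) (l := [x]) (by simp)
    rw [pbw_cons, pbw_nil, mul_one] at hx
    rw [contract_coproduct_pbw_cons, ih hl.of_cons, hx]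
    · by_cases hxh : x = h
      · subst hxh
        rw [if_pos (listFoliage_singleton x).symm, List.count_cons_self, List.erase_cons_head,
          Nat.cast_succ, add_smul, one_smul, add_left_inj]
        -- If `x` recurs, it is the head of `l` as well, and erasing then prefixing it restores `l`.
        by_cases hm : x ∈ l
        · cases l with
          | nil => simp at hm
          | cons y l =>
            have hyx : y = x := by
              refine le_antisymm ((List.pairwise_cons.1 hl).1 y (by simp)) ?_
              rcases List.mem_cons.1 hm with e | hm
              · exact e.le
              · exact (List.pairwise_cons.1 hl.of_cons).1 x hm
            subst hyx
            rw [List.erase_cons_head, mul_smul_comm, ← pbw_cons]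
        · rw [List.count_eq_zero.2 hm]
          simp
      · rw [if_neg, zero_smul, add_zero, List.count_cons_of_ne hxh, List.erase_cons_tail
          (by simpa using hxh), pbw_cons, mul_smul_comm]
        rw [← listFoliage_singleton]
        intro e
        have := decreasing_unique hH (by simp) (by simp) e
        exact hxh (by simpa using this.symm)
    · intro m hm hne
      exact coord_foliage_eq_zero hH h (hl.sublist (hm.cons_cons x)) (by
        have := List.length_pos_iff.2 hne
        simp; omega)

/-- Adjoint to `contract_coord_foliage`: only the monomial of `l ++ [y]` has derivative a multiple
of that of `l`, with factor its multiplicity of `y`. -/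
theorem shuffle_dualPBW_foliage (hH : IsHallSet H) {l : List H} (hl : Decreasing l) {y : H}
    (hy : ∀ z ∈ l, y ≤ z) :
    shuffle (dualPBW hH (listFoliage l)) (dualPBW hH (foliage y.1)) =
      ((l.count y + 1 : ℕ) : ℝ) • dualPBW hH (listFoliage l * foliage y.1) := by
  have : DecidableEq (FreeMonoid A) := Classical.decEq _
  apply pairingHom_injective
  refine (pbwBasis hH).ext fun u => ?_
  have hu := decreasing_hallFactorization hH u
  generalize hallFactorization hH u = m, pbwBasis_apply hH u = e at hu
  rw [e, pairingHom_shuffle, pairingHom_dualPBW, pairingHom_dualPBW, contract_coord_foliage hH y hu,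
    map_smul, map_smul, LinearMap.smul_apply, pairingHom_dualPBW,
    coord_pbw hH _ (hu.sublist List.erase_sublist), coord_pbw hH _ hu]
  have hly := decreasing_concat hl hy
  have hiff : listFoliage l * foliage y.1 = listFoliage m ↔ m = l ++ [y] := by
    rw [← listFoliage_singleton, ← listFoliage_append]
    exact ⟨fun h => (decreasing_unique hH hly hu h).symm, fun h => by rw [h]⟩
  simp only [hiff]
  by_cases hm : y ∈ m
  · have hiff' : listFoliage l = listFoliage (m.erase y) ↔ m = l ++ [y] := by
      constructor
      · intro h
        have h := decreasing_unique hH hl (hu.sublist List.erase_sublist) h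
        refine List.Perm.eq_of_pairwise (fun a b _ _ h₁ h₂ => le_antisymm h₂ h₁) hu hly ?_
        rw [h]
        exact (List.perm_cons_erase hm).trans (List.perm_append_singleton _ _).symm
      · intro h
        congr 1
        refine List.Perm.eq_of_pairwise (fun a b _ _ h₁ h₂ => le_antisymm h₂ h₁) hl
          (hu.sublist List.erase_sublist) ?_
        refine List.Perm.cons_inv (a := y) ?_
        refine (List.perm_append_singleton _ _).symm.trans ?_
        rw [← h]
        exact List.perm_cons_erase hm
    simp only [hiff']
    split_ifs with h
    · rw [h]; simp
    · simp
  · have hne : m ≠ l ++ [y] := by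
      rintro rfl
      simp at hm
    simp [List.count_eq_zero.2 hm, hne]

/-- The letter `a` of the left comb pulls out of both dual elements and turns `≺` into a shuffle;
its factor `count + 1` is the Lazard exponent. -/
theorem halfShuffle_dualPBW (hH : IsHallSet H) {x y : FreeMagma A} (h : x * y ∈ H) :
    halfShuffle (dualPBW hH (foliage x)) (dualPBW hH (foliage y)) =
      (lazardExponent (x * y) : ℝ) • dualPBW hH (foliage (x * y)) := by
  obtain ⟨mx, my, -⟩ := (hH.mul_mem_iff x y).1 h
  obtain ⟨a, l, hl, e, -⟩ := hH.exists_leftComb h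
  induction l using List.reverseRecOn with
  | nil => cases e
  | append_singleton l z _ =>
    rw [leftComb_concat] at e
    obtain ⟨rfl, rfl⟩ : x = leftComb (FreeMagma.of a) l ∧ y = z.1 := by cases e; exact ⟨rfl, rfl⟩
    have hp := List.pairwise_append.1 hl
    have hz : ∀ u ∈ l, z ≤ u := fun u hu => hp.2.2 u hu z (by simp)
    have ex : foliage (leftComb (FreeMagma.of a) l) = FreeMonoid.of a * listFoliage l :=
      foliage_leftComb _ l
    have exy : foliage (leftComb (FreeMagma.of a) l * z.1) =
        FreeMonoid.of a * (listFoliage l * foliage z.1) := by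
      rw [foliage_mul, ex, mul_assoc]
    have hk : lazardExponent (leftComb (FreeMagma.of a) l * z.1) =
      rightMultiplicity z.1 (leftComb (FreeMagma.of a) l) + 1 := rfl
    rw [dualPBW_foliage hH (h := ⟨_, mx⟩) ex, dualPBW_foliage hH (h := ⟨_, h⟩) exy,
      halfShuffle_letter_mul, shuffle_dualPBW_foliage hH hp.1 hz, hk,
      rightMultiplicity_leftComb a hp.1 hz, mul_smul_comm]

theorem dualPBW_foliage_eq (hH : IsHallSet H) {h : FreeMagma A} (hh : h ∈ H) :
    dualPBW hH (foliage h) = (accLazardDepth h : ℝ) • halfShuffleTree h := by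
  induction h with
  | ih1 a =>
    rw [dualPBW_foliage hH (h := ⟨_, hh⟩) (a := a) (v := 1) (by simp), dualPBW_one]
    simp [accLazardDepth, halfShuffleTree, treeEval]
  | ih2 x y ihx ihy =>
    obtain ⟨mx, my, -⟩ := (hH.mul_mem_iff x y).1 hh
    have h := halfShuffle_dualPBW hH hh
    have hk : (lazardExponent (x * y) : ℝ) ≠ 0 :=
      Nat.cast_ne_zero.2 (Nat.succ_ne_zero (rightMultiplicity y x))
    have hs : halfShuffleTree (x * y) = halfShuffle (halfShuffleTree x) (halfShuffleTree y) := rfl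
    have hacc : accLazardDepth (x * y) =
      lazardDepth (x * y) * accLazardDepth x * accLazardDepth y := rfl
    rw [ihx mx, ihy my, map_smul, map_smul, LinearMap.smul_apply, ← hs] at h
    rw [← inv_smul_smul₀ hk (dualPBW hH (foliage (x * y))), ← h, hacc, lazardDepth]
    simp only [smul_smul]
    congr 1
    push_cast
    ring

end

end
end HallIntegral

theorem mainTheorem3 {A : Type*} [Finite A] (H : Set (FreeMagma A)) [LinearOrder H]
    (hH : IsHallSet H) :
    (∀ w : FreeMonoid A, ∃! l : List H, IsHallFactorization H w l) ∧
    ∃ S : FreeMonoid A → TensorAlg A,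
      IsDualPBW H S ∧
      (∀ S' : FreeMonoid A → TensorAlg A, IsDualPBW H S' → S' = S) ∧
      ∀ h ∈ H, S (foliage h) = (accLazardDepth h : ℝ) • halfShuffleTree h :=
  ⟨existsUnique_hallFactorization hH, dualPBW hH, isDualPBW_dualPBW hH,
    fun _ hS' => hS'.eq_dualPBW hH, fun _ hh => dualPBW_foliage_eq hH hh⟩
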